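/- Let $(Z_n)_{n\ge1}$ be i.i.d. standard normal random variables, $\sigma>0$, $(\mu_n)_{n\ge1}$ real numbers, and let the demand in period $n$ be $D_n=\mu_n+\sigma Z_n$. Let $0<c\le p$ be the unit production cost and the unit lost-sales penalty. For $\kappa\in\mathbb R$ consider the production plan with $x_1+\dots+x_n=\mu_1+\dots+\mu_n+\kappa\sigma\sqrt n$ for all $n\ge 1$, starting from zero inventory. Let $L_N(\kappa)$ be the cumulative lost sales up to period $N$ under this plan, where in each period the demand exceeding the new production plus the inventory carried over is lost and any surplus is carried over; equivalently $L_N(\kappa)=\max_{0\le n\le N}\big(\sigma\sum_{i=1}^nZ_i-\kappa\sigma\sqrt n\big)$. Put $$J_N(\kappa)=c\sigma\kappa\sqrt N+p\,\mathbb E[L_N(\kappa)],\qquad J_N^*=\inf_{\kappa\in\mathbb R}J_N(\kappa).$$ Let $B$ be a standard Brownian motion and $\rho(\kappa)=\mathbb E\big[\sup_{0\le t\le1}(B_t-\kappa\sqrt t)\big]$. Let $\kappa^*\in\mathbb R$ be a minimizer over $\kappa\in\mathbb R$ of the Brownian surrogate cost $\big(c\sigma\kappa+p\sigma\rho(\kappa)\big)\sqrt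 N$ (the factor $\sqrt N$ does not affect the minimizer, so $\kappa^*$ does not depend on $N$). Then $0<J_N^*<\infty$ for every $N\ge1$, and $\kappa^*$ is asymptotically optimal: $$\limsup_{N\to\infty}\frac{J_N(\kappa^*)}{J_N^*}\le1.$$ -/

import Mathlib

open MeasureTheory ProbabilityTheory Filter

namespace LostSalesModel

noncomputable section

/-- Inventory on hand at the end of each period, in the lost-sales model, along a sequence of
productions `x` and demands `d` (periods are numbered `1, 2, …`; the system starts empty). -/
def onHand (x d : ℕ → ℝ) : ℕ → ℝ
  | 0 => 0
  | n + 1 => max (onHand x d n + x (n + 1) - d (n + 1)) 0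

/-- Cumulative lost sales up to each period: in period `n + 1`, the demand that exceeds the new
production plus the inventory left from period `n` is lost. -/
def lostSales (x d : ℕ → ℝ) : ℕ → ℝ
  | 0 => 0
  | n + 1 => lostSales x d n + max (d (n + 1) - x (n + 1) - onHand x d n) 0

/-- Inventory balance: stock is lost sales minus the partial sum of `d - x`. -/
theorem onHand_eq (x d : ℕ → ℝ) (n : ℕ) :
    onHand x d n = lostSales x d n - ∑ i ∈ Finset.range n, (d (i + 1) - x (i + 1)) := by
  induction n with
  | zero => simp [onHand, lostSales]
  | succ n ih =>
    rw [Finset.sum_range_succ, onHand, lostSales]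
    rcases le_total (onHand x d n + x (n + 1) - d (n + 1)) 0 with h | h
    · rw [max_eq_right h, max_eq_left (by linarith)]; linarith
    · rw [max_eq_left h, max_eq_right (by linarith)]; linarith

/-- The cumulative lost sales are the running maximum of the partial sums of `d - x`. -/
theorem lostSales_eq_sup' (x d : ℕ → ℝ) (n : ℕ) :
    lostSales x d n = (Finset.range (n + 1)).sup' Finset.nonempty_range_add_one
      (fun j => ∑ i ∈ Finset.range j, (d (i + 1) - x (i + 1))) := by
  induction n with
  | zero => simp [lostSales]
  | succ n ih =>
    have h : ∀ f : ℕ → ℝ, (Finset.range (n + 1 + 1)).sup' Finset.nonempty_range_add_one f =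
        max (f (n + 1)) ((Finset.range (n + 1)).sup' Finset.nonempty_range_add_one f) := by
      intro f
      simp only [Finset.range_add_one (n := n + 1)]
      rw [Finset.sup'_insert (H := Finset.nonempty_range_add_one)]
    rw [h, ← ih, Finset.sum_range_succ, lostSales, onHand_eq]
    rcases le_total (d (n + 1) - x (n + 1) - (lostSales x d n -
      ∑ i ∈ Finset.range n, (d (i + 1) - x (i + 1)))) 0 with h' | h'
    · rw [max_eq_right h', max_eq_right (by linarith)]; linarith
    · rw [max_eq_left h', max_eq_left (by linarith)]; linarith

/-- Demand in period `n`, with mean `μ n` and forecast error `σ * Z n`. -/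
def demand {Ω : Type*} (μ : ℕ → ℝ) (σ : ℝ) (Z : ℕ → Ω → ℝ) (ω : Ω) (n : ℕ) : ℝ :=
  μ n + σ * Z n ω

/-- Production in period `n ≥ 1` with square-root safety stock, i.e. the plan with
`x 1 + ⋯ + x n = μ 1 + ⋯ + μ n + κ * σ * √n`. -/
def production (μ : ℕ → ℝ) (σ κ : ℝ) (n : ℕ) : ℝ :=
  μ n + κ * σ * (√(n : ℝ) - √((n : ℝ) - 1))

/-- The objective `J_N(κ) = c σ κ √N + p E[L_N(κ)]` (the production cost, without the constant
`c * (μ 1 + ⋯ + μ N)`, plus the expected lost-sales penalty). -/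
def cost {Ω : Type*} [MeasurableSpace Ω] (P : Measure Ω) (μ : ℕ → ℝ) (Z : ℕ → Ω → ℝ)
    (c p σ : ℝ) (N : ℕ) (κ : ℝ) : ℝ :=
  c * σ * κ * √(N : ℝ) +
    p * ∫ ω, lostSales (production μ σ κ) (demand μ σ Z ω) N ∂P

/-- The optimal value `J_N^*`. -/
def optimalCost {Ω : Type*} [MeasurableSpace Ω] (P : Measure Ω) (μ : ℕ → ℝ) (Z : ℕ → Ω → ℝ)
    (c p σ : ℝ) (N : ℕ) : ℝ :=
  ⨅ κ : ℝ, cost P μ Z c p σ N κ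

/-- `ρ(κ) = E[sup_{0 ≤ t ≤ 1} (B_t - κ √t)]`, for a Brownian motion `B`. -/
def rho {Ω' : Type*} [MeasurableSpace Ω'] (P' : Measure Ω') (B : NNReal → Ω' → ℝ) (κ : ℝ) : ℝ :=
  ∫ ω, (⨆ t : Set.Icc (0 : NNReal) 1, (B (t : NNReal) ω - κ * √((t : NNReal) : ℝ))) ∂P'

/-- The Brownian surrogate objective per unit of `√N`. -/
def brownianCost {Ω' : Type*} [MeasurableSpace Ω'] (P' : Measure Ω') (B : NNReal → Ω' → ℝ)
    (c p σ : ℝ) (κ : ℝ) : ℝ :=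
  c * σ * κ + p * σ * rho P' B κ

end

end LostSalesModel

/-! Brownian scaling turns the Gaussian walk into √N times a Brownian motion sampled on the grid
j/N, so J_N(κ) = σ√N (cκ + p r_N(κ)) with r_N = `gridRho` (`cost_eq`). Pointwise r_N → ρ by
dominated convergence (`tendsto_gridRho`); the dominating path supremum is integrable by Doob's L²
inequality on grids and Fatou.

Each r_N is 1-Lipschitz in κ, which makes lower bounds uniform on compact sets; r_N ≥ 0 and r_N(κ) ≥
-κ give the cost slopes c and p - c at ±∞. Hence minimization commutes with the limit when c < p
(`eventually_forall_lt`): J_N^*/(σ√N) and J_N(κ*)/(σ√N) share the positive limit M = min (cκ +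
pρ(κ)), and their ratio tends to 1.

The case c = p cannot occur: the surrogate cost is then positive but tends to 0 as κ → -∞, so it has
no minimizer (`lt_of_isMinOn_brownianCost`). -/

open scoped NNReal Topology

namespace LostSalesModel

/-! ### Running maxima and suprema of deterministic paths -/

/-- The running maximum satisfies the one-step inequality behind the pathwise Doob inequality. -/
lemma sq_partialSups_succ_le (x : ℕ → ℝ) (n : ℕ) :
    (partialSups x (n + 1)) ^ 2 / 2 - partialSups x (n + 1) * x (n + 1) ≤
      (partialSups x n) ^ 2 / 2 - partialSups x n * x n - partialSups x n * (x (n + 1) - x n) := by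
  rw [partialSups_add_one]
  rcases le_total (partialSups x n) (x (n + 1)) with h | h
  -- At a new record the two sides differ by half this square; otherwise they are equal.
  · rw [sup_eq_right.2 h]; nlinarith [sq_nonneg (partialSups x n - x (n + 1))]
  · rw [sup_eq_left.2 h]; nlinarith

/-- Grid maxima of a continuous function converge to its supremum on the unit interval. -/
lemma tendsto_partialSups_grid {g : ℝ≥0 → ℝ} (hg : Continuous g) :
    Tendsto (fun N : ℕ => partialSups (fun j : ℕ => g (j / N)) N) atTop
      (𝓝 (⨆ t : Set.Icc (0 : ℝ≥0) 1, g t)) := by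
  obtain ⟨t₀, ht₀, hmax⟩ := (isCompact_Icc (a := (0 : ℝ≥0)) (b := 1)).exists_isMaxOn
    ⟨0, by simp⟩ hg.continuousOn
  have hsup : (⨆ t : Set.Icc (0 : ℝ≥0) 1, g t) = g t₀ := by
    have : Nonempty (Set.Icc (0 : ℝ≥0) 1) := ⟨⟨t₀, ht₀⟩⟩
    refine le_antisymm (ciSup_le fun t => hmax t.2) ?_
    exact le_ciSup (f := fun t : Set.Icc (0 : ℝ≥0) 1 => g t)
      ⟨g t₀, by rintro _ ⟨t, rfl⟩; exact hmax t.2⟩ ⟨t₀, ht₀⟩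
  rw [hsup]
  have hfloor : Tendsto (fun N : ℕ => ((⌊(t₀ : ℝ) * N⌋₊ : ℝ≥0) / (N : ℝ≥0))) atTop (𝓝 t₀) := by
    rw [← NNReal.tendsto_coe]
    have := (tendsto_nat_floor_mul_div_atTop (R := ℝ) t₀.2).comp tendsto_natCast_atTop_atTop
    simpa [Function.comp_def] using this
  refine tendsto_of_tendsto_of_tendsto_of_le_of_le ((hg.tendsto t₀).comp hfloor)
    tendsto_const_nhds (fun N => ?_) (fun N => ?_)
  · refine le_partialSups_of_le (fun j : ℕ => g (j / N)) ?_
    refine Nat.floor_le_of_le ?_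
    have : (t₀ : ℝ) ≤ 1 := by exact_mod_cast ht₀.2
    nlinarith [Nat.cast_nonneg (α := ℝ) N]
  · refine partialSups_le _ _ _ fun j hj => hmax ⟨zero_le, ?_⟩
    exact div_le_one_of_le₀ (by exact_mod_cast hj) zero_le

lemma bddAbove_range_unitInterval {g : ℝ≥0 → ℝ} (hg : Continuous g) :
    BddAbove (Set.range fun t : Set.Icc (0 : ℝ≥0) 1 => g t) := by
  have := (isCompact_Icc (a := (0 : ℝ≥0)) (b := 1)).bddAbove_image hg.continuousOn
  rwa [Set.image_eq_range] at this

/-- A steep penalty vanishing only at time one localizes the supremum at time one. -/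
lemma tendsto_iSup_add_sqrt {g : ℝ≥0 → ℝ} (hg : Continuous g) :
    Tendsto (fun n : ℕ => (⨆ t : Set.Icc (0 : ℝ≥0) 1, (g t - (-(n : ℝ)) * √((t : ℝ≥0) : ℝ))) - n)
      atTop (𝓝 (g 1)) := by
  have : Nonempty (Set.Icc (0 : ℝ≥0) 1) := ⟨⟨0, by simp⟩⟩
  have hb (n : ℕ) := bddAbove_range_unitInterval (g := fun t => g t - (-(n : ℝ)) * √(t : ℝ))
    (by fun_prop)
  obtain ⟨C, hC⟩ := bddAbove_range_unitInterval hg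
  refine tendsto_order.2 ⟨fun a ha => Eventually.of_forall fun n => ?_, fun a ha => ?_⟩
  · have := le_ciSup (hb n) ⟨1, by simp⟩
    simp at this ⊢
    linarith
  · obtain ⟨b, hb1, hb2⟩ := exists_between ha
    have hnear : ∀ᶠ t in 𝓝 (1 : ℝ≥0), g t < b := (hg.tendsto 1).eventually_lt_const hb1
    obtain ⟨δ, hδ, hball⟩ := Metric.eventually_nhds_iff.1 hnear
    -- For δ > 1 the root is 0 by convention, so no bound on δ is needed.
    have hs : √(1 - δ) < 1 := by
      rw [Real.sqrt_lt' one_pos]; linarith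
    obtain ⟨n₀, hn₀⟩ := exists_nat_ge ((C - b) / (1 - √(1 - δ)))
    filter_upwards [eventually_ge_atTop n₀] with n hn
    have hn' : (C - b) / (1 - √(1 - δ)) ≤ n := hn₀.trans (by exact_mod_cast hn)
    rw [div_le_iff₀ (by linarith)] at hn'
    refine lt_of_le_of_lt ?_ hb2
    rw [sub_le_iff_le_add]
    refine ciSup_le fun t => ?_
    have ht1 : ((t : ℝ≥0) : ℝ) ≤ 1 := by exact_mod_cast t.2.2
    have hn0 : (0 : ℝ) ≤ n := Nat.cast_nonneg n
    by_cases h : 1 - δ < ((t : ℝ≥0) : ℝ)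
    · have h1 : g t < b := hball (by
        rw [NNReal.dist_eq, abs_sub_lt_iff]; constructor <;> simp <;> linarith)
      have h2 : √((t : ℝ≥0) : ℝ) ≤ 1 := Real.sqrt_le_one.2 ht1
      nlinarith
    · have h2 : √((t : ℝ≥0) : ℝ) ≤ √(1 - δ) := Real.sqrt_le_sqrt (by linarith)
      have h3 : g t ≤ C := hC ⟨t, rfl⟩
      nlinarith

lemma memLp_partialSups {Ω : Type*} [MeasurableSpace Ω] {P : Measure Ω} {X : ℕ → Ω → ℝ} {q : ENNReal}
    (h : ∀ n, MemLp (X n) q P) (n : ℕ) : MemLp (fun ω => partialSups (fun j => X j ω) n) q P := by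
  induction n with
  | zero => simpa using h 0
  | succ n ih =>
    simp only [partialSups_add_one]
    exact ih.sup (h (n + 1))

lemma measurable_partialSups {Ω : Type*} [MeasurableSpace Ω] {X : ℕ → Ω → ℝ} {n : ℕ}
    (h : ∀ j ≤ n, Measurable (X j)) : Measurable (fun ω => partialSups (fun j => X j ω) n) := by
  induction n with
  | zero => simpa using h 0 le_rfl
  | succ n ih =>
    simp only [partialSups_add_one]
    exact (ih fun j hj => h j (by omega)).sup (h (n + 1) le_rfl)

lemma monotone_natCast_div (N : ℕ) : Monotone fun j : ℕ => (j : ℝ≥0) / N := fun _ _ hij =>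
  div_le_div_of_nonneg_right (Nat.cast_le.2 hij) zero_le

/-! ### Brownian motion: Doob's inequality, grid maxima and their expectations -/

section Brownian

variable {Ω : Type*} [MeasurableSpace Ω] {P : Measure Ω} {B : ℝ≥0 → Ω → ℝ}

lemma memLp_two_eval (hB : IsPreBrownianReal B P) (t : ℝ≥0) : MemLp (B t) 2 P :=
  (hB.hasLaw_eval t).hasGaussianLaw.memLp_two

lemma integral_sq_eval (hB : IsPreBrownianReal B P) (t : ℝ≥0) : ∫ ω, B t ω ^ 2 ∂P = t := by
  have := hB.isGaussianProcess.isProbabilityMeasure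
  have h := hB.covariance_eval t t
  rw [covariance_self (hB.aemeasurable t), variance_of_integral_eq_zero (hB.aemeasurable t)
    (hB.integral_eval t), min_self] at h
  exact h

/-- The running maximum along a deterministic grid is orthogonal to the next increment. -/
lemma integral_partialSups_mul_increment (hB : IsPreBrownianReal B P) {t : ℕ → ℝ≥0}
    (ht : Monotone t) (n : ℕ) :
    ∫ ω, partialSups (fun j => B (t j) ω) n * (B (t (n + 1)) ω - B (t n) ω) ∂P = 0 := by
  have hind := hB.indepFun_shift (t n)
  let φ : (ℝ≥0 → ℝ) → ℝ := fun y => y (t (n + 1) - t n)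
  let ψ : (Set.Iic (t n) → ℝ) → ℝ := fun y =>
    -- Truncating at `n` keeps every index in the past of `t n`; it changes nothing for j ≤ n.
    partialSups (fun j => y ⟨t (min j n), ht (min_le_right _ _)⟩) n
  have hψ : Measurable ψ := measurable_partialSups fun j _ => measurable_pi_apply _
  have hφ : Measurable φ := measurable_pi_apply _
  have h := (hind.comp hφ hψ).symm
  have e1 : (ψ ∘ fun ω (s : Set.Iic (t n)) => B s ω) =
      fun ω => partialSups (fun j => B (t j) ω) n := by
    ext ω
    simp only [ψ, Function.comp_apply, partialSups_eq_sup'_range]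
    refine Finset.sup'_congr _ rfl fun j hj => ?_
    rw [min_eq_left (Finset.mem_range_succ_iff.1 hj)]
  have e2 : (φ ∘ fun ω s => B (t n + s) ω - B (t n) ω) =
      fun ω => B (t (n + 1)) ω - B (t n) ω := by
    ext ω
    simp only [φ, Function.comp_apply]
    rw [add_tsub_cancel_of_le (ht n.le_succ)]
  rw [e1, e2] at h
  rw [h.integral_fun_mul_eq_mul_integral
    (memLp_partialSups (fun j => memLp_two_eval hB (t j)) n).aestronglyMeasurable
    ((hB.aemeasurable _).sub (hB.aemeasurable _)).aestronglyMeasurable,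
    integral_sub (hB.integrable_eval _) (hB.integrable_eval _), hB.integral_eval, hB.integral_eval]
  simp

/-- Doob's `L²` inequality along a deterministic grid. -/
lemma integral_sq_partialSups_le (hB : IsPreBrownianReal B P) {t : ℕ → ℝ≥0}
    (ht : Monotone t) (n : ℕ) :
    ∫ ω, (partialSups (fun j => B (t j) ω) n) ^ 2 ∂P ≤ 4 * t n := by
  have hM (n : ℕ) := memLp_partialSups (fun j => memLp_two_eval hB (t j)) n
  have hX (n : ℕ) := memLp_two_eval hB (t n)
  have hMX (n m : ℕ) : Integrable (fun ω => partialSups (fun j => B (t j) ω) n * B (t m) ω) P :=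
    (hM n).integrable_mul (hX m)
  have hMM (n : ℕ) : Integrable (fun ω => (partialSups (fun j => B (t j) ω) n) ^ 2 / 2) P :=
    (hM n).integrable_sq.div_const 2
  have hMd (n : ℕ) : Integrable (fun ω => partialSups (fun j => B (t j) ω) n *
      (B (t (n + 1)) ω - B (t n) ω)) P :=
    (hM n).integrable_mul ((hX (n + 1)).sub (hX n))
  -- With M the running maximum and X the walk, E[M²/2 - MX] does not increase with n, and it starts
  -- at -E[X₀²]/2.
  have key : ∫ ω, ((partialSups (fun j => B (t j) ω) n) ^ 2 / 2 -
      partialSups (fun j => B (t j) ω) n * B (t n) ω) ∂P ≤ 0 := by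
    induction n with
    | zero =>
      refine integral_nonpos fun ω => ?_
      simp only [partialSups_zero, Pi.zero_apply]
      nlinarith [sq_nonneg (B (t 0) ω)]
    | succ n ih =>
      have hstep := integral_mono ((hMM (n + 1)).sub (hMX (n + 1) (n + 1)))
        (((hMM n).sub (hMX n n)).sub (hMd n))
        (fun ω => sq_partialSups_succ_le (fun j => B (t j) ω) n)
      rw [integral_sub' ((hMM n).sub (hMX n n)) (hMd n),
        integral_partialSups_mul_increment hB ht, sub_zero] at hstep
      exact hstep.trans ih
  -- M² ≤ 4(M²/2 - MX) + 4X² is (M - 2X)² ≥ 0.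
  have hsq := integral_mono (μ := P) ((hM n).integrable_sq)
    ((((hMM n).sub (hMX n n)).const_mul 4).add ((hX n).integrable_sq.const_mul 4))
    (fun ω => by
      simp only [Pi.add_apply, Pi.sub_apply]
      nlinarith [sq_nonneg (partialSups (fun j => B (t j) ω) n - 2 * B (t n) ω)])
  rw [integral_add' (((hMM n).sub (hMX n n)).const_mul 4) ((hX n).integrable_sq.const_mul 4),
    integral_const_mul, integral_const_mul, integral_sq_eval hB] at hsq
  simp only [Pi.sub_apply] at hsq
  linarith

/-- The maximum of a path, penalized by `κ √t`, over a uniform grid of the unit interval. -/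
noncomputable def gridMax (b : ℝ≥0 → ℝ) (κ : ℝ) (N : ℕ) : ℝ :=
  partialSups (fun j : ℕ => b (j / N) - κ * √((j / N : ℝ≥0) : ℝ)) N

/-- The supremum of a path, penalized by `κ √t`, over the unit interval. -/
noncomputable def pathSup (b : ℝ≥0 → ℝ) (κ : ℝ) : ℝ :=
  ⨆ t : Set.Icc (0 : ℝ≥0) 1, (b (t : ℝ≥0) - κ * √((t : ℝ≥0) : ℝ))

lemma memLp_two_gridMax (hB : IsPreBrownianReal B P) (κ : ℝ) (N : ℕ) :
    MemLp (fun ω => gridMax (B · ω) κ N) 2 P := by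
  have := hB.isGaussianProcess.isProbabilityMeasure
  exact memLp_partialSups (fun j => (memLp_two_eval hB _).sub (memLp_const _)) N

lemma integrable_gridMax (hB : IsPreBrownianReal B P) (κ : ℝ) (N : ℕ) :
    Integrable (fun ω => gridMax (B · ω) κ N) P := by
  have := hB.isGaussianProcess.isProbabilityMeasure
  exact (memLp_two_gridMax hB κ N).integrable (by norm_num)

lemma gridMax_nonneg {b : ℝ≥0 → ℝ} (hb : b 0 = 0) (κ : ℝ) (N : ℕ) : 0 ≤ gridMax b κ N := by
  have := le_partialSups_of_le (fun j : ℕ => b (j / N) - κ * √((j / N : ℝ≥0) : ℝ)) (Nat.zero_le N)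
  simpa [gridMax, hb] using this

lemma sub_le_gridMax (b : ℝ≥0 → ℝ) (κ : ℝ) {N : ℕ} (hN : 1 ≤ N) : b 1 - κ ≤ gridMax b κ N := by
  have := le_partialSups_of_le (fun j : ℕ => b (j / N) - κ * √((j / N : ℝ≥0) : ℝ)) (le_refl N)
  have hN' : (N : ℝ≥0) ≠ 0 := by positivity
  simpa [gridMax, div_self hN'] using this

/-- The coefficient √t of κ lies in [0, 1] on the grid. -/
lemma gridMax_le_add (b : ℝ≥0 → ℝ) (κ κ' : ℝ) (N : ℕ) :
    gridMax b κ N ≤ gridMax b κ' N + |κ - κ'| := by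
  refine partialSups_le _ _ _ fun j hj => ?_
  have h1 := le_partialSups_of_le (fun j : ℕ => b (j / N) - κ' * √((j / N : ℝ≥0) : ℝ)) hj
  have h2 : √((j / N : ℝ≥0) : ℝ) ≤ 1 := by
    rw [Real.sqrt_le_one]
    exact_mod_cast div_le_one_of_le₀ (by exact_mod_cast hj) zero_le
  have h3 := Real.sqrt_nonneg ((j / N : ℝ≥0) : ℝ)
  have h4 := neg_abs_le (κ - κ')
  change _ ≤ partialSups (fun j : ℕ => b (j / N) - κ' * √((j / N : ℝ≥0) : ℝ)) N + _
  nlinarith [abs_nonneg (κ - κ')]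

lemma gridMax_le_pathSup {b : ℝ≥0 → ℝ} (hb : Continuous b) (κ : ℝ) (N : ℕ) :
    gridMax b κ N ≤ pathSup b κ := by
  have hbdd := bddAbove_range_unitInterval (g := fun t => b t - κ * √(t : ℝ)) (by fun_prop)
  exact partialSups_le _ _ _ fun j hj => le_ciSup hbdd
    ⟨(j / N : ℝ≥0), zero_le, div_le_one_of_le₀ (by exact_mod_cast hj) zero_le⟩

lemma tendsto_gridMax {b : ℝ≥0 → ℝ} (hb : Continuous b) (κ : ℝ) :
    Tendsto (gridMax b κ) atTop (𝓝 (pathSup b κ)) :=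
  tendsto_partialSups_grid (g := fun t => b t - κ * √(t : ℝ)) (by fun_prop)

lemma pathSup_le_add {b : ℝ≥0 → ℝ} (hb : Continuous b) (κ κ' : ℝ) :
    pathSup b κ ≤ pathSup b κ' + |κ - κ'| :=
  le_of_tendsto_of_tendsto' (tendsto_gridMax hb κ) ((tendsto_gridMax hb κ').add_const _)
    fun N => gridMax_le_add b κ κ' N

/-- The Brownian supremum is integrable. -/
lemma integrable_pathSup (hB : IsBrownianReal B P) (κ : ℝ) :
    Integrable (fun ω => pathSup (B · ω) κ) P := by
  have := hB.isGaussianProcess.isProbabilityMeasure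
  have hlim (κ : ℝ) : ∀ᵐ ω ∂P, Tendsto (fun N => gridMax (B · ω) κ N) atTop
      (𝓝 (pathSup (B · ω) κ)) := by
    filter_upwards [hB.cont] with ω hω using tendsto_gridMax hω κ
  have hmeas (κ : ℝ) : AEMeasurable (fun ω => pathSup (B · ω) κ) P :=
    aemeasurable_of_tendsto_metrizable_ae atTop
      (fun N => (integrable_gridMax hB.toIsPreBrownianReal κ N).aemeasurable) (hlim κ)
  have h0 : MemLp (fun ω => pathSup (B · ω) 0) 2 P := by
    refine ⟨(hmeas 0).aestronglyMeasurable, ?_⟩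
    -- Fatou: Doob bounds every grid maximum by 2 in L².
    have hle := Lp.eLpNorm_lim_le_liminf_eLpNorm (p := 2)
      (fun N => (memLp_two_gridMax hB.toIsPreBrownianReal 0 N).aestronglyMeasurable) _ (hlim 0)
    refine hle.trans_lt (lt_of_le_of_lt (b := 2)
      (liminf_le_of_frequently_le' (Frequently.of_forall fun N => ?_)) (by simp))
    have hsq := integral_sq_partialSups_le hB.toIsPreBrownianReal
      (t := fun j : ℕ => (j : ℝ≥0) / N) (monotone_natCast_div N) N
    have hN : (((N : ℝ≥0) / N : ℝ≥0) : ℝ) ≤ 1 := by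
      exact_mod_cast div_self_le_one (N : ℝ≥0)
    have hM := memLp_two_gridMax hB.toIsPreBrownianReal 0 N
    rw [hM.eLpNorm_eq_integral_rpow_norm (by norm_num) (by norm_num)]
    refine ENNReal.ofReal_le_of_le_toReal ?_
    simp only [ENNReal.toReal_ofNat, Real.rpow_ofNat, Real.norm_eq_abs, sq_abs]
    rw [← one_div, ← Real.sqrt_eq_rpow, Real.sqrt_le_left (by norm_num)]
    simp only [gridMax, zero_mul, sub_zero]
    linarith
  refine ((h0.integrable (by norm_num)).norm.add (integrable_const |κ|)).mono'
    (hmeas κ).aestronglyMeasurable ?_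
  filter_upwards [hB.cont, hB.eval_zero_ae_eq_zero] with ω hω hω0
  have h1 := pathSup_le_add hω κ 0
  have h2 := (gridMax_nonneg (b := (B · ω)) hω0 κ 0).trans (gridMax_le_pathSup hω κ 0)
  simp only [Pi.add_apply]
  rw [Real.norm_of_nonneg h2]
  rw [sub_zero] at h1
  linarith [Real.le_norm_self (pathSup (B · ω) 0)]

/-- The expected penalized maximum over a uniform grid. -/
noncomputable def gridRho (P : Measure Ω) (B : ℝ≥0 → Ω → ℝ) (N : ℕ) (κ : ℝ) : ℝ :=
  ∫ ω, gridMax (B · ω) κ N ∂P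

lemma gridRho_nonneg (hB : IsPreBrownianReal B P) (N : ℕ) (κ : ℝ) : 0 ≤ gridRho P B N κ :=
  integral_nonneg_of_ae <| by
    filter_upwards [hB.eval_zero_ae_eq_zero] with ω h0 using gridMax_nonneg h0 κ N

lemma gridRho_le_add (hB : IsPreBrownianReal B P) (N : ℕ) (κ κ' : ℝ) :
    gridRho P B N κ ≤ gridRho P B N κ' + |κ - κ'| := by
  have := hB.isGaussianProcess.isProbabilityMeasure
  have h := integral_mono (μ := P) (integrable_gridMax hB κ N)
    ((integrable_gridMax hB κ' N).add (integrable_const |κ - κ'|))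
    (fun ω => gridMax_le_add (B · ω) κ κ' N)
  rw [integral_add' (integrable_gridMax hB κ' N) (integrable_const _)] at h
  simpa [gridRho] using h

lemma gridRho_le_rho (hB : IsBrownianReal B P) (N : ℕ) (κ : ℝ) :
    gridRho P B N κ ≤ rho P B κ :=
  integral_mono_ae (integrable_gridMax hB.toIsPreBrownianReal κ N) (integrable_pathSup hB κ) <| by
    filter_upwards [hB.cont] with ω hω using gridMax_le_pathSup hω κ N

lemma tendsto_gridRho (hB : IsBrownianReal B P) (κ : ℝ) :
    Tendsto (fun N => gridRho P B N κ) atTop (𝓝 (rho P B κ)) := by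
  refine tendsto_integral_of_dominated_convergence (fun ω => pathSup (B · ω) κ)
    (fun N => (integrable_gridMax hB.toIsPreBrownianReal κ N).aestronglyMeasurable)
    (integrable_pathSup hB κ) (fun N => ?_) ?_
  · filter_upwards [hB.cont, hB.eval_zero_ae_eq_zero] with ω hω h0
    rw [Real.norm_of_nonneg (gridMax_nonneg h0 κ N)]
    exact gridMax_le_pathSup hω κ N
  · filter_upwards [hB.cont] with ω hω using tendsto_gridMax hω κ

/-- As the safety factor tends to `-∞`, the expected supremum approaches its linear lower bound. -/
lemma tendsto_rho_neg_sub (hB : IsBrownianReal B P) :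
    Tendsto (fun n : ℕ => rho P B (-n) - n) atTop (𝓝 0) := by
  have := hB.isGaussianProcess.isProbabilityMeasure
  have heq (n : ℕ) : rho P B (-n) - n = ∫ ω, (pathSup (B · ω) (-n) - n) ∂P := by
    rw [integral_sub (integrable_pathSup hB _) (integrable_const _)]
    simp [rho, pathSup]
  simp_rw [heq]
  rw [← hB.integral_eval 1]
  refine tendsto_integral_of_dominated_convergence
    (fun ω => ‖B 1 ω‖ + ‖pathSup (B · ω) 0‖)
    (fun n => ((integrable_pathSup hB _).sub (integrable_const _)).aestronglyMeasurable)
    ((hB.integrable_eval 1).norm.add (integrable_pathSup hB 0).norm) (fun n => ?_) ?_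
  · filter_upwards [hB.cont] with ω hω
    have h1 := (sub_le_gridMax (B · ω) (-n) le_rfl).trans (gridMax_le_pathSup hω (-n) 1)
    have h2 := pathSup_le_add hω (-n) 0
    rw [sub_zero, abs_neg, Nat.abs_cast] at h2
    simp only [Real.norm_eq_abs]
    rw [abs_le]
    constructor
    · linarith [neg_abs_le (B 1 ω), abs_nonneg (pathSup (B · ω) 0)]
    · linarith [le_abs_self (pathSup (B · ω) 0), abs_nonneg (B 1 ω)]
  · filter_upwards [hB.cont] with ω hω using tendsto_iSup_add_sqrt hω

/-- As B₁ has mean zero, this is E[(κ - B₁)⁺], positive because the Gaussian law charges (-∞, κ). -/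
lemma integral_max_const_eval_pos (hB : IsPreBrownianReal B P) (κ : ℝ) :
    0 < ∫ ω, max κ (B 1 ω) ∂P := by
  have := hB.isGaussianProcess.isProbabilityMeasure
  have hint : Integrable (fun ω => max κ (B 1 ω)) P :=
    (integrable_const κ).sup (hB.integrable_eval 1)
  have hsub : ∫ ω, max κ (B 1 ω) ∂P = ∫ ω, (max κ (B 1 ω) - B 1 ω) ∂P := by
    rw [integral_sub hint (hB.integrable_eval 1), hB.integral_eval, sub_zero]
  have hnn : 0 ≤ᵐ[P] fun ω => max κ (B 1 ω) - B 1 ω :=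
    ae_of_all _ fun ω => sub_nonneg.2 (le_max_right _ _)
  rw [hsub]
  refine (integral_nonneg_of_ae hnn).lt_of_ne' fun h => ?_
  rw [integral_eq_zero_iff_of_nonneg_ae hnn (hint.sub (hB.integrable_eval 1))] at h
  have hae : ∀ᵐ x ∂(gaussianReal 0 1), κ ≤ x := by
    rw [← (hB.hasLaw_eval 1).map_eq, ae_map_iff (hB.aemeasurable 1) measurableSet_Ici]
    filter_upwards [h] with ω hω
    have : max κ (B 1 ω) = B 1 ω := sub_eq_zero.1 hω
    exact max_eq_right_iff.1 this
  have hvol : ∀ᵐ x : ℝ, κ ≤ x := (gaussianReal_absolutelyContinuous' 0 one_ne_zero).ae_le hae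
  rw [ae_iff] at hvol
  simp only [not_le] at hvol
  rw [show {a : ℝ | a < κ} = Set.Iio κ from rfl, Real.volume_Iio] at hvol
  exact ENNReal.top_ne_zero hvol

/-- Only the grid endpoints 0 and 1 are used, so the lower bound is uniform in N. -/
lemma integral_max_const_eval_le (hB : IsPreBrownianReal B P) (κ : ℝ) {N : ℕ} (hN : 1 ≤ N) :
    ∫ ω, max κ (B 1 ω) ∂P ≤ gridRho P B N κ + κ := by
  have := hB.isGaussianProcess.isProbabilityMeasure
  have hint : Integrable (fun ω => max κ (B 1 ω)) P :=
    (integrable_const κ).sup (hB.integrable_eval 1)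
  have h := integral_mono_ae hint ((integrable_gridMax hB κ N).add (integrable_const κ)) <| by
    filter_upwards [hB.eval_zero_ae_eq_zero] with ω h0
    have h1 := sub_le_gridMax (B · ω) κ hN
    have h2 := gridMax_nonneg (b := (B · ω)) h0 κ N
    simp only [Pi.add_apply]
    exact max_le (by linarith) (by linarith)
  rw [integral_add' (integrable_gridMax hB κ N) (integrable_const _)] at h
  simpa [gridRho] using h

end Brownian

/-! ### Lost sales as a Gaussian walk, and its Brownian scaling -/

/-- Maximum of the partial sums of `y`, penalized by a square-root boundary. -/
noncomputable def walkMax (y : ℕ → ℝ) (κ : ℝ) (N : ℕ) : ℝ :=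
  partialSups (fun j : ℕ => ∑ i ∈ Finset.range j, y i - κ * √(j : ℝ)) N

lemma measurable_walkMax (κ : ℝ) (N : ℕ) : Measurable fun y : ℕ → ℝ => walkMax y κ N :=
  measurable_partialSups fun j _ => by fun_prop

lemma partialSups_const_mul {a : ℝ} (ha : 0 ≤ a) (x : ℕ → ℝ) (n : ℕ) :
    partialSups (fun j => a * x j) n = a * partialSups x n := by
  induction n with
  | zero => simp
  | succ n ih => rw [partialSups_add_one, partialSups_add_one, ih, mul_max_of_nonneg _ _ ha]

lemma lostSales_eq_walkMax {Ω : Type*} (μ : ℕ → ℝ) {σ : ℝ} (hσ : 0 ≤ σ) (κ : ℝ) (Z : ℕ → Ω → ℝ)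
    (ω : Ω) (N : ℕ) :
    lostSales (production μ σ κ) (demand μ σ Z ω) N =
      σ * walkMax (fun i => Z (i + 1) ω) κ N := by
  rw [lostSales_eq_sup', walkMax, ← partialSups_const_mul hσ, partialSups_eq_sup'_range]
  refine Finset.sup'_congr _ rfl fun j _ => ?_
  have h (i : ℕ) : demand μ σ Z ω (i + 1) - production μ σ κ (i + 1) =
      σ * Z (i + 1) ω - κ * σ * (√((i + 1 : ℕ) : ℝ) - √(i : ℝ)) := by
    simp only [demand, production]
    push_cast
    rw [add_sub_cancel_right]
    ring
  simp_rw [h]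
  rw [Finset.sum_sub_distrib, ← Finset.mul_sum, ← Finset.mul_sum,
    Finset.sum_range_sub (fun i : ℕ => √(i : ℝ))]
  simp
  ring

lemma walkMax_increments {b : ℝ≥0 → ℝ} (hb : b 0 = 0) (κ : ℝ) (N : ℕ) :
    walkMax (fun i => √(N : ℝ) * (b ((i + 1 : ℕ) / N) - b (i / N))) κ N =
      √(N : ℝ) * gridMax b κ N := by
  rcases Nat.eq_zero_or_pos N with rfl | hN
  · simp [walkMax]
  rw [walkMax, gridMax, ← partialSups_const_mul (Real.sqrt_nonneg _)]
  congr 2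
  ext j
  rw [← Finset.mul_sum, Finset.sum_range_sub (fun i : ℕ => b (i / N))]
  have : √((j / N : ℝ≥0) : ℝ) = √(j : ℝ) / √(N : ℝ) := by
    push_cast
    exact Real.sqrt_div (Nat.cast_nonneg j) _
  rw [this]
  have : √(N : ℝ) ≠ 0 := by positivity
  simp only [Nat.cast_zero, zero_div, hb, sub_zero]
  field_simp

section

variable {Ω : Type*} [MeasurableSpace Ω] {P : Measure Ω} {Ω' : Type*} [MeasurableSpace Ω']
  {P' : Measure Ω'} {Z : ℕ → Ω → ℝ} {B : ℝ≥0 → Ω' → ℝ}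

lemma hasLaw_grid_increment (hB : IsPreBrownianReal B P') {N : ℕ} (hN : 1 ≤ N) (i : ℕ) :
    HasLaw (fun ω => √(N : ℝ) * (B ((i + 1 : ℕ) / N) ω - B (i / N) ω)) (gaussianReal 0 1) P' := by
  have h := gaussianReal_const_mul (hB.hasLaw_sub ((i + 1 : ℕ) / N) (i / N)) √(N : ℝ)
  have hN0 : (N : ℝ) ≠ 0 := by positivity
  have hv : NNReal.mk (√(N : ℝ) ^ 2) (sq_nonneg _) *
      nndist (((i + 1 : ℕ) / N : ℝ≥0) : ℝ) ((i / N : ℝ≥0) : ℝ) = 1 := by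
    ext
    simp only [NNReal.coe_one, NNReal.coe_mul, NNReal.coe_mk, coe_nndist, Real.dist_eq]
    push_cast
    rw [Real.sq_sqrt (Nat.cast_nonneg N), ← sub_div, add_sub_cancel_left,
      abs_of_nonneg (by positivity)]
    field_simp
  rw [mul_zero] at h
  exact hv ▸ h

lemma identDistrib_grid_increments (hZ_law : ∀ n, HasLaw (Z n) (gaussianReal 0 1) P)
    (hZ_indep : iIndepFun Z P) (hB : IsPreBrownianReal B P') {N : ℕ} (hN : 1 ≤ N) :
    IdentDistrib (fun ω (i : ℕ) => Z (i + 1) ω)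
      (fun ω (i : ℕ) => √(N : ℝ) * (B ((i + 1 : ℕ) / N) ω - B (i / N) ω)) P P' := by
  have hind : iIndepFun
      (fun (i : ℕ) ω => √(N : ℝ) * (B ((i + 1 : ℕ) / N) ω - B (i / N) ω)) P' :=
    (hB.hasIndepIncrements.nat (monotone_natCast_div N)).comp (fun _ x => √(N : ℝ) * x)
      (fun _ => measurable_const_mul _)
  exact IdentDistrib.pi (X := fun i ω => Z (i + 1) ω)
    (Y := fun i ω => √(N : ℝ) * (B ((i + 1 : ℕ) / N) ω - B (i / N) ω))
    (fun i => ⟨(hZ_law (i + 1)).aemeasurable, (hasLaw_grid_increment hB hN i).aemeasurable,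
      (hZ_law (i + 1)).map_eq.trans (hasLaw_grid_increment hB hN i).map_eq.symm⟩)
    (hZ_indep.precomp (add_left_injective 1)) hind

/-- The Gaussian walk is a rescaled Brownian motion observed on a uniform grid. -/
lemma integral_walkMax (hZ_law : ∀ n, HasLaw (Z n) (gaussianReal 0 1) P) (hZ_indep : iIndepFun Z P)
    (hB : IsPreBrownianReal B P') (κ : ℝ) (N : ℕ) :
    ∫ ω, walkMax (fun i => Z (i + 1) ω) κ N ∂P = √(N : ℝ) * gridRho P' B N κ := by
  rcases Nat.eq_zero_or_pos N with h0 | hN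
  · subst h0
    have h (y : ℕ → ℝ) : walkMax y κ 0 = 0 := by simp [walkMax]
    simp_rw [h]
    simp
  have h := ((identDistrib_grid_increments hZ_law hZ_indep hB hN).comp
    (measurable_walkMax κ N)).integral_eq
  simp only [Function.comp_def] at h
  have h' : ∫ ω, walkMax (fun i => √(N : ℝ) * (B ((i + 1 : ℕ) / N) ω - B (i / N) ω)) κ N ∂P' =
      ∫ ω, √(N : ℝ) * gridMax (B · ω) κ N ∂P' := by
    refine integral_congr_ae ?_
    filter_upwards [hB.eval_zero_ae_eq_zero] with ω h0
    exact walkMax_increments (b := fun t => B t ω) h0 κ N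
  rw [gridRho, ← integral_const_mul, ← h', h]

lemma cost_eq (hZ_law : ∀ n, HasLaw (Z n) (gaussianReal 0 1) P) (hZ_indep : iIndepFun Z P)
    (hB : IsPreBrownianReal B P') (μ : ℕ → ℝ) (c p : ℝ) {σ : ℝ} (hσ : 0 ≤ σ) (N : ℕ) (κ : ℝ) :
    cost P μ Z c p σ N κ = σ * √(N : ℝ) * (c * κ + p * gridRho P' B N κ) := by
  simp_rw [cost, lostSales_eq_walkMax μ hσ]
  rw [integral_const_mul, integral_walkMax hZ_law hZ_indep hB]
  ring

end

/-! ### Deterministic bounds for costs cκ + p r(κ) -/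

section Optimization

variable {c p m : ℝ}

/-- A cost `c κ + p r(κ)` with positive slopes on both sides is bounded away from zero. -/
lemma exists_pos_forall_le (hc : 0 < c) (hcp : c < p) (hm : 0 < m) :
    ∃ L > 0, ∀ r : ℝ → ℝ, (∀ κ, 0 ≤ r κ) → (∀ κ, 0 ≤ r κ + κ) → m ≤ r 0 →
      (∀ κ κ', r κ ≤ r κ' + |κ - κ'|) → ∀ κ, L ≤ c * κ + p * r κ := by
  have hp : 0 < p := hc.trans hcp
  -- For |κ| ≤ δ the Lipschitz loss is at most (p + c)δ, half of the value p m available at κ = 0.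
  set δ := p * m / (2 * (p + c)) with hδ
  have hδ0 : 0 < δ := by positivity
  have hδ' : (p + c) * δ = p * m / 2 := by rw [hδ]; field_simp
  refine ⟨min (p * m / 2) (min (c * δ) ((p - c) * δ)), ?_, fun r h0 h1 h2 h3 κ => ?_⟩
  · have : 0 < p - c := sub_pos.2 hcp
    positivity
  have h0' := h0 κ
  have h1' := h1 κ
  rcases le_total δ κ with h | h
  · refine (min_le_right _ _).trans ((min_le_left _ _).trans ?_)
    nlinarith
  rcases le_total κ (-δ) with h' | h'
  · refine (min_le_right _ _).trans ((min_le_right _ _).trans ?_)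
    nlinarith
  · refine (min_le_left _ _).trans ?_
    have hk : |κ| ≤ δ := abs_le.2 ⟨h', h⟩
    have h4 := h3 0 κ
    rw [zero_sub, abs_neg] at h4
    have h5 := neg_abs_le κ
    have h6 : p * m ≤ p * r κ + p * |κ| := by nlinarith
    nlinarith

/-- Asymptotically uniform lower bound for a pointwise convergent sequence of costs. -/
lemma eventually_forall_lt {r : ℕ → ℝ → ℝ} {s : ℝ → ℝ} {M : ℝ} (hc : 0 < c) (hcp : c < p)
    (h0 : ∀ N κ, 0 ≤ r N κ) (h1 : ∀ᶠ N in atTop, ∀ κ, 0 ≤ r N κ + κ)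
    (h2 : ∀ N κ κ', r N κ ≤ r N κ' + |κ - κ'|)
    (hlim : ∀ κ, Tendsto (fun N => r N κ) atTop (𝓝 (s κ)))
    (hM : ∀ κ, M ≤ c * κ + p * s κ) {a : ℝ} (ha : a < M) :
    ∀ᶠ N in atTop, ∀ κ, a ≤ c * κ + p * r N κ := by
  have hp : 0 < p := hc.trans hcp
  -- Outside this interval the cost is at least M: on the right by cκ alone, on the left by r(κ) ≥
  -- -κ.
  have hK : ∀ᶠ N in atTop, ∀ κ ∈ Set.Icc (-(M / (p - c))) (M / c), a ≤ c * κ + p * r N κ := by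
    refine isCompact_Icc.induction_on (p := fun S => ∀ᶠ N in atTop, ∀ κ ∈ S,
      a ≤ c * κ + p * r N κ) (by simp)
      (fun S T hST hT => hT.mono fun N h κ hκ => h κ (hST hκ))
      (fun S T hS hT => (hS.and hT).mono fun N h κ hκ => hκ.elim (h.1 κ) (h.2 κ))
      fun κ _ => ?_
    -- Moving κ by less than ε costs at most half the gap M - a; pointwise convergence absorbs the
    -- other half.
    set ε := (M - a) / (2 * (p + c))
    have hε : 0 < ε := div_pos (sub_pos.2 ha) (by positivity)
    have hε' : (p + c) * ε = (M - a) / 2 := by simp only [ε]; field_simp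
    refine ⟨Metric.ball κ ε, mem_nhdsWithin_of_mem_nhds (Metric.ball_mem_nhds κ hε), ?_⟩
    have hpt : Tendsto (fun N => c * κ + p * r N κ) atTop (𝓝 (c * κ + p * s κ)) :=
      ((hlim κ).const_mul p).const_add _
    have hlt : (M + a) / 2 < c * κ + p * s κ := by linarith [hM κ]
    filter_upwards [hpt.eventually_const_lt hlt] with N hN κ' hκ'
    have hd : |κ - κ'| < ε := by rwa [Metric.mem_ball, dist_comm, Real.dist_eq] at hκ'
    have hL := h2 N κ κ'
    have hcκ : c * κ ≤ c * κ' + c * |κ - κ'| := by nlinarith [le_abs_self (κ - κ')]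
    have hpr : p * r N κ ≤ p * r N κ' + p * |κ - κ'| := by nlinarith
    nlinarith
  filter_upwards [hK, h1] with N hN hN1 κ
  rcases le_total κ (M / c) with h | h
  · rcases le_total (-(M / (p - c))) κ with h' | h'
    · exact hN κ ⟨h', h⟩
    · have hpc : 0 < p - c := sub_pos.2 hcp
      have h3 : M / (p - c) ≤ -κ := by linarith
      rw [div_le_iff₀ hpc] at h3
      nlinarith [hN1 κ]
  · rw [div_le_iff₀ hc] at h
    nlinarith [h0 N κ]

end Optimization

/-! ### Positivity of the costs and exclusion of c = p -/

variable {Ω' : Type*} [MeasurableSpace Ω'] {P' : Measure Ω'} {B : ℝ≥0 → Ω' → ℝ}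

lemma gridRho_add_pos (hB : IsPreBrownianReal B P') {N : ℕ} (hN : 1 ≤ N) (κ : ℝ) :
    0 < gridRho P' B N κ + κ :=
  (integral_max_const_eval_pos hB κ).trans_le (integral_max_const_eval_le hB κ hN)

lemma brownianCost_pos (hB : IsBrownianReal B P') {c p σ : ℝ} (hσ : 0 < σ) (hc : 0 < c)
    (hcp : c ≤ p) (κ : ℝ) : 0 < brownianCost P' B c p σ κ := by
  have h1 := gridRho_add_pos hB.toIsPreBrownianReal le_rfl κ
  have h2 := gridRho_nonneg hB.toIsPreBrownianReal 1 κ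
  have h3 := gridRho_le_rho hB 1 κ
  have h4 : 0 < c * (κ + rho P' B κ) := mul_pos hc (by linarith)
  have h5 : 0 ≤ (p - c) * rho P' B κ := mul_nonneg (by linarith) (by linarith)
  have : brownianCost P' B c p σ κ =
      σ * (c * (κ + rho P' B κ) + (p - c) * rho P' B κ) := by rw [brownianCost]; ring
  rw [this]
  exact mul_pos hσ (by linarith)

/-- With equal unit costs the Brownian surrogate has no minimizer. -/
lemma lt_of_isMinOn_brownianCost (hB : IsBrownianReal B P') {c p σ κ : ℝ} (hσ : 0 < σ) (hc : 0 < c)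
    (hcp : c ≤ p) (hκ : IsMinOn (brownianCost P' B c p σ) Set.univ κ) : c < p := by
  refine hcp.lt_of_ne fun h => ?_
  subst h
  have hlim : Tendsto (fun n : ℕ => c * σ * (rho P' B (-n) - n)) atTop (𝓝 (c * σ * 0)) :=
    (tendsto_rho_neg_sub hB).const_mul _
  have hle := ge_of_tendsto' hlim (b := brownianCost P' B c c σ κ) fun n => by
    refine (hκ (Set.mem_univ (-(n : ℝ)))).trans_eq ?_
    rw [brownianCost]
    ring
  rw [mul_zero] at hle
  exact (brownianCost_pos hB hσ hc le_rfl κ).not_ge hle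

end LostSalesModel

/-! ### Asymptotic optimality -/

open LostSalesModel in
theorem mainTheorem2
    {Ω : Type*} [MeasurableSpace Ω] (P : Measure Ω) [IsProbabilityMeasure P]
    {Ω' : Type*} [MeasurableSpace Ω'] (P' : Measure Ω') [IsProbabilityMeasure P']
    (Z : ℕ → Ω → ℝ) (hZ_law : ∀ n, HasLaw (Z n) (gaussianReal 0 1) P) (hZ_indep : iIndepFun Z P)
    (B : NNReal → Ω' → ℝ) (hB : IsBrownianReal B P')
    (μ : ℕ → ℝ) (c p σ : ℝ) (hσ : 0 < σ) (hc : 0 < c) (hcp : c ≤ p)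
    (κstar : ℝ) (hκ : IsMinOn (LostSalesModel.brownianCost P' B c p σ) Set.univ κstar) :
    (∀ N : ℕ, 1 ≤ N → BddBelow (Set.range (LostSalesModel.cost P μ Z c p σ N)) ∧
      0 < LostSalesModel.optimalCost P μ Z c p σ N) ∧
    limsup (fun N : ℕ => ((LostSalesModel.cost P μ Z c p σ N κstar /
      LostSalesModel.optimalCost P μ Z c p σ N : ℝ) : EReal)) atTop ≤ 1 := by
  have hcp' : c < p := lt_of_isMinOn_brownianCost hB hσ hc hcp hκ
  have hp : 0 < p := hc.trans hcp'
  have hBp := hB.toIsPreBrownianReal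
  have hcost (N : ℕ) (κ : ℝ) : cost P μ Z c p σ N κ =
      σ * √(N : ℝ) * (c * κ + p * gridRho P' B N κ) :=
    cost_eq hZ_law hZ_indep hBp μ c p hσ.le N κ
  have h0 := gridRho_nonneg hBp
  have h1 (N : ℕ) (hN : 1 ≤ N) (κ : ℝ) : 0 ≤ gridRho P' B N κ + κ := (gridRho_add_pos hBp hN κ).le
  have hscale (N : ℕ) (hN : 1 ≤ N) : 0 < σ * √(N : ℝ) := by positivity
  obtain ⟨L, hL, hbound⟩ := exists_pos_forall_le hc hcp' (integral_max_const_eval_pos hBp 0)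
  have hlower (N : ℕ) (hN : 1 ≤ N) (κ : ℝ) : L ≤ c * κ + p * gridRho P' B N κ :=
    hbound _ (h0 N) (h1 N hN)
      ((integral_max_const_eval_le hBp 0 hN).trans_eq (add_zero _)) (gridRho_le_add hBp N) κ
  have hopt {a : ℝ} {N : ℕ} (h : ∀ κ, a ≤ c * κ + p * gridRho P' B N κ) :
      σ * √(N : ℝ) * a ≤ optimalCost P μ Z c p σ N :=
    le_ciInf fun κ => by
      rw [hcost]
      exact mul_le_mul_of_nonneg_left (h κ) (by positivity)
  have hbdd (N : ℕ) (hN : 1 ≤ N) : BddBelow (Set.range (cost P μ Z c p σ N)) := by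
    refine ⟨σ * √(N : ℝ) * L, ?_⟩
    rintro _ ⟨κ, rfl⟩
    rw [hcost]
    exact mul_le_mul_of_nonneg_left (hlower N hN κ) (hscale N hN).le
  have hpos (N : ℕ) (hN : 1 ≤ N) : 0 < optimalCost P μ Z c p σ N :=
    (mul_pos (hscale N hN) hL).trans_le (hopt (hlower N hN))
  refine ⟨fun N hN => ⟨hbdd N hN, hpos N hN⟩, ?_⟩
  set M := c * κstar + p * rho P' B κstar with hMdef
  have hM (κ : ℝ) : M ≤ c * κ + p * rho P' B κ := by
    have h : brownianCost P' B c p σ κstar ≤ brownianCost P' B c p σ κ := hκ (Set.mem_univ κ)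
    refine le_of_mul_le_mul_left ?_ hσ
    simp only [brownianCost] at h
    linarith
  have hnum : Tendsto (fun N => c * κstar + p * gridRho P' B N κstar) atTop (𝓝 M) :=
    ((tendsto_gridRho hB κstar).const_mul p).const_add _
  have hMpos : 0 < M := hL.trans_le (ge_of_tendsto hnum
    ((eventually_ge_atTop 1).mono fun N hN => hlower N hN κstar))
  -- Lower half: the bound uniform in κ. Upper half: κ* is one admissible choice.
  have hden : Tendsto (fun N : ℕ => optimalCost P μ Z c p σ N / (σ * √(N : ℝ))) atTop (𝓝 M) := by
    refine tendsto_order.2 ⟨fun a ha => ?_, fun a ha => ?_⟩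
    · obtain ⟨b, hab, hbM⟩ := exists_between ha
      filter_upwards [eventually_forall_lt hc hcp' h0 ((eventually_ge_atTop 1).mono h1)
        (gridRho_le_add hBp) (tendsto_gridRho hB) hM hbM, eventually_ge_atTop 1] with N h hN
      rw [lt_div_iff₀' (hscale N hN)]
      exact (mul_lt_mul_of_pos_left hab (hscale N hN)).trans_le (hopt h)
    · filter_upwards [hnum.eventually_lt_const ha, eventually_ge_atTop 1] with N h hN
      rw [div_lt_iff₀' (hscale N hN)]
      refine (ciInf_le (hbdd N hN) κstar).trans_lt ?_
      rw [hcost]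
      exact mul_lt_mul_of_pos_left h (hscale N hN)
  have hratio : Tendsto (fun N : ℕ => cost P μ Z c p σ N κstar / optimalCost P μ Z c p σ N) atTop
      (𝓝 1) := by
    rw [← div_self hMpos.ne']
    refine (hnum.div hden hMpos.ne').congr' ?_
    filter_upwards [eventually_ge_atTop 1] with N hN
    have hs := (hscale N hN).ne'
    have ho := (hpos N hN).ne'
    rw [Pi.div_apply, hcost]
    field_simp
  exact ((continuous_coe_real_ereal.tendsto 1).comp hratio).limsup_eq.le
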